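/- Let $G$ be a finite group. Its difference graph $\mathcal{D}(G)$ is obtained from the graph on vertex set $G$ in which two distinct elements $x,y$ are adjacent if and only if $x,y\in\langle z\rangle$ for some $z\in G$, but $x\notin\langle y\rangle$ and $y\notin\langle x\rangle$ (i.e. the enhanced power graph minus the power graph), by removing all isolated vertices. A graph is planar if it can be drawn in the plane without edge crossings. A maximal cyclic subgroup of a group is a cyclic subgroup that is not properly contained in any other cyclic subgroup. Let $G$ be a finite nilpotent group which is not a $p$-group for any prime $p$. Then $\mathcal{D}(G)$ is planar if and only if $G$ is of one of the following forms: (i) $G\cong\mathbb{Z}_2\times P$, where $P$ is a $p$-group of exponent $p$ for some prime $p>2$; (ii) $G\cong\mathbb{Z}_3\times P$, where $P$ is a $p$-group of exponent $p$ for some prime $p>3$; (iii) $G\cong P\times\mathbb{Z}_3$, where $P$ is a $2$-group of exponent $4$ such that any two distinct maximal cyclic subgroups of $P$ have trivial intersection; (iv) $G\cong\mathbb{Z}_2\times\cdots\times\mathbb{Z}_2\times\mathbb{Z}_3$, with $k\ge 1$ factors $\mathbb{Z}_2$. -/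

import Mathlib

universe u

/-- The power graph of `G`: distinct elements are adjacent when one is a power of the other. -/
def powerGraph (G : Type*) [Group G] : SimpleGraph G where
  Adj x y := x ≠ y ∧ (x ∈ Subgroup.zpowers y ∨ y ∈ Subgroup.zpowers x)
  symm := ⟨fun _ _ h => ⟨h.1.symm, h.2.symm⟩⟩
  loopless := ⟨fun _ h => h.1 rfl⟩

/-- The enhanced power graph of `G`: distinct elements are adjacent when both are powers of a
common element. -/
def enhancedPowerGraph (G : Type*) [Group G] : SimpleGraph G where
  Adj x y := x ≠ y ∧ ∃ z : G, x ∈ Subgroup.zpowers z ∧ y ∈ Subgroup.zpowers z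
  symm := ⟨fun _ _ h => ⟨h.1.symm, h.2.imp fun _ hz => hz.symm⟩⟩
  loopless := ⟨fun _ h => h.1 rfl⟩

/-- The enhanced power graph minus (the edges of) the power graph, on the whole of `G`. -/
def fullDifferenceGraph (G : Type*) [Group G] : SimpleGraph G :=
  enhancedPowerGraph G \ powerGraph G

/-- The difference graph `D(G)`: the enhanced power graph minus the power graph, with all
isolated vertices removed (the support of a graph is the set of its non-isolated vertices). -/
def differenceGraph (G : Type*) [Group G] : SimpleGraph (fullDifferenceGraph G).support :=
  (fullDifferenceGraph G).induce (fullDifferenceGraph G).support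

/-- A drawing of the graph `Γ` in the plane `ℝ²` without edge crossings: distinct vertices are
distinct points, every edge is a simple continuous arc joining its two ends, an arc passes through
no vertex other than its ends, and two distinct arcs meet only in common ends. (Only the topology
of the plane matters here.) -/
structure PlaneDrawing {V : Type*} (Γ : SimpleGraph V) where
  /-- the position of each vertex -/
  point : V → ℝ × ℝ
  /-- the arc representing each edge -/
  arc : Γ.edgeSet → unitInterval → ℝ × ℝ
  point_injective : Function.Injective point
  arc_continuous : ∀ e, Continuous (arc e)
  arc_injective : ∀ e, Function.Injective (arc e)
  /-- the ends of the arc of `e` are the positions of the two ends of `e` -/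
  arc_ends : ∀ e, s(arc e 0, arc e 1) = (e : Sym2 V).map point
  /-- an arc meets no vertex but the ends of its edge -/
  mem_of_arc_eq_point : ∀ e t v, arc e t = point v → v ∈ (e : Sym2 V)
  /-- arcs of distinct edges meet only in common ends -/
  arc_inter : ∀ e f, e ≠ f → ∀ s t, arc e s = arc f t →
    ∃ v, v ∈ (e : Sym2 V) ∧ v ∈ (f : Sym2 V) ∧ arc e s = point v

/-- A graph is planar if it can be drawn in the plane without edge crossings. -/
def IsPlanar {V : Type*} (Γ : SimpleGraph V) : Prop :=
  Nonempty (PlaneDrawing Γ)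

/-- `M` is a maximal cyclic subgroup of `G`: it is cyclic and is not properly contained in any
cyclic subgroup of `G`. -/
def IsMaximalCyclic {G : Type*} [Group G] (M : Subgroup G) : Prop :=
  Maximal (fun H : Subgroup G => IsCyclic H) M

/-- The cyclic group `ℤ_n` of order `n` (for `n ≥ 1`), written multiplicatively. -/
abbrev CyclicOfOrder (n : ℕ) : Type := Multiplicative (ZMod n)

/-! Three primes dividing the order already give a K₃,₃, so a planar case is a product `P × Q` of
two Sylow subgroups. There powers are tested factor by factor, and within a `p`-group two powers of
a common element are comparable. Hence `(a, u)` and `(b, v)` are adjacent exactly when the strict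
"is a power of" relations in the two factors point in opposite directions
(`fullDifferenceGraph_prod_adj`).

Every obstruction is a K₃,₃ with one side `(1, y i)`: two factors of order at least 4, an element of
order `q²` with `q` odd, an element of order 8, or two maximal cyclic subgroups with nontrivial
intersection (the last two when the other factor has order at least 3). What survives is the list of
the theorem.

Conversely, in each listed group one factor has at most two nontrivial elements. They become hubs,
the elements of the other factor are joined to them, and pairs `a, a⁻¹` with a common nontrivial
proper power close small quadrilaterals. All of this sits in one explicitly drawn "strand graph".

Nonplanarity of K₃,₃ is proved by winding numbers. For disjoint arcs the difference of their points
has a logarithm on the whole parameter square, so its variation round the boundary is zero.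
Comparing with fixed logarithms of the differences of the six vertices turns this into integer
equations, contradictory modulo 2. -/

/-! ### Continuous logarithms and the nonplanarity of K₃,₃. -/

/-- A nowhere vanishing continuous function on a simply connected, locally path-connected space
has a continuous logarithm. -/
theorem exists_continuous_log {X : Type*} [TopologicalSpace X] [SimplyConnectedSpace X]
    [LocallyPathConnectedSpace X] (g : C(X, ℂ)) (hg : ∀ x, g x ≠ 0) :
    ∃ L : C(X, ℂ), ∀ x, Complex.exp (L x) = g x := by
  obtain ⟨x₀⟩ : Nonempty X := inferInstance
  obtain ⟨L, ⟨-, hL⟩, -⟩ := Complex.isCoveringMapOn_exp.existsUnique_continuousMap_lifts g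
    (a₀ := x₀) (e₀ := Complex.log (g x₀)) (Complex.exp_log (hg x₀)) (fun x => hg x)
  exact ⟨L, fun x => congrFun hL x⟩

/-- Two continuous logarithms of the same function have the same variation. -/
theorem sub_eq_sub_of_exp_eq {X : Type*} [TopologicalSpace X] [PreconnectedSpace X]
    {L M : X → ℂ} (hL : Continuous L) (hM : Continuous M)
    (h : ∀ x, Complex.exp (L x) = Complex.exp (M x)) (x y : X) : L y - L x = M y - M x := by
  have hpi : (2 * Real.pi * Complex.I : ℂ) ≠ 0 := Complex.two_pi_I_ne_zero
  choose n hn using fun x => Complex.exp_eq_exp_iff_exists_int.1 (h x)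
  have hc : Continuous fun x => ((n x : ℤ) : ℝ) := by
    have h1 : (fun x => ((n x : ℤ) : ℝ)) =
        fun x => ((L x - M x) / (2 * Real.pi * Complex.I)).re := by
      funext x
      rw [hn x, add_sub_cancel_left, mul_div_cancel_right₀ _ hpi, Complex.intCast_re]
    rw [h1]
    fun_prop
  have hn' : Continuous n := Int.isClosedEmbedding_coe_real.continuous_iff.2 hc
  have := PreconnectedSpace.constant ‹_› hn' (x := x) (y := y)
  rw [hn x, hn y, this]
  ring


/-- The variation of a logarithm along a path depends only on the path up to a scalar. -/
theorem exists_variation_eq (g : ℝ → ℂ) (hg : Continuous g) (h0 : ∀ x, g x ≠ 0) :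
    ∃ v : ℂ, ∀ L : ℝ → ℂ, Continuous L → (∃ c : ℂ, ∀ x, Complex.exp (L x) = c * g x) →
      L 1 - L 0 = v := by
  obtain ⟨M, hM⟩ := exists_continuous_log ⟨g, hg⟩ h0
  refine ⟨M 1 - M 0, fun L hL ⟨c, hc⟩ => ?_⟩
  have hc0 : c ≠ 0 := by
    rintro rfl
    exact Complex.exp_ne_zero (L 0) (by rw [hc, zero_mul])
  have := sub_eq_sub_of_exp_eq hL (M := fun x => Complex.log c + M x)
    (by fun_prop) (fun x => by
      rw [hc, Complex.exp_add, Complex.exp_log hc0, hM]; rfl) 0 1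
  rw [this]
  ring

/-- If the nine arcs joining three points `A i` to three points `B j` are such that arcs without
a common end are disjoint, then we get a contradiction: in every continuous map of `K₃,₃` to the
plane the images of two independent edges meet. -/
theorem false_of_independent_arcs_disjoint (A B : Fin 3 → ℂ) (γ : Fin 3 → Fin 3 → ℝ → ℂ)
    (hγ : ∀ i j, Continuous (γ i j)) (h0 : ∀ i j, γ i j 0 = A i) (h1 : ∀ i j, γ i j 1 = B j)
    (hd : ∀ i j i' j', i ≠ i' → j ≠ j' → ∀ s t, γ i j s ≠ γ i' j' t) : False := by
  have hother : ∀ k : Fin 3, ∃ l, k ≠ l := by decide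
  have hAγ : ∀ k i j, k ≠ i → ∀ s, γ i j s - A k ≠ 0 := by
    intro k i j hk s h
    obtain ⟨l, hl⟩ := hother j
    exact hd i j k l hk.symm hl s 0 (by rw [h0, sub_eq_zero.1 h])
  have hBγ : ∀ k i j, k ≠ j → ∀ s, γ i j s - B k ≠ 0 := by
    intro k i j hk s h
    obtain ⟨l, hl⟩ := hother i
    exact hd i j l k hl hk.symm s 1 (by rw [h1, sub_eq_zero.1 h])
  have hA : ∀ k i, k ≠ i → A i - A k ≠ 0 := fun k i h => by simpa [h0] using hAγ k i 0 h 0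
  have hB : ∀ k j, k ≠ j → B j - B k ≠ 0 := fun k j h => by simpa [h1] using hBγ k 0 j h 1
  have hAB : ∀ k j, B j - A k ≠ 0 := fun k j => by
    obtain ⟨l, hl⟩ := hother k
    simpa [h1] using hAγ k l j hl 1
  -- `a k i j`, `b k i j`: variations of the logarithm along the arc `i j`, seen from `A k`, `B k`
  have ha : ∀ k i j, ∃ v : ℂ, k ≠ i → ∀ L : ℝ → ℂ, Continuous L →
      (∃ c : ℂ, ∀ x, Complex.exp (L x) = c * (γ i j x - A k)) → L 1 - L 0 = v := by
    intro k i j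
    by_cases hk : k = i
    · exact ⟨0, fun h => absurd hk h⟩
    · obtain ⟨v, hv⟩ := exists_variation_eq (fun x => γ i j x - A k)
        ((hγ i j).sub continuous_const) (hAγ k i j hk)
      exact ⟨v, fun _ => hv⟩
  have hb : ∀ k i j, ∃ v : ℂ, k ≠ j → ∀ L : ℝ → ℂ, Continuous L →
      (∃ c : ℂ, ∀ x, Complex.exp (L x) = c * (γ i j x - B k)) → L 1 - L 0 = v := by
    intro k i j
    by_cases hk : k = j
    · exact ⟨0, fun h => absurd hk h⟩
    · obtain ⟨v, hv⟩ := exists_variation_eq (fun x => γ i j x - B k)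
        ((hγ i j).sub continuous_const) (hBγ k i j hk)
      exact ⟨v, fun _ => hv⟩
  choose a ha using ha
  choose b hb using hb
  -- On each side of the parameter square one of the two points is a fixed vertex, so the four sides
  -- contribute variations seen from `A` or `B`.
  have hsq : ∀ i j i' j', i ≠ i' → j ≠ j' →
      a i' i j + b j i' j' - b j' i j - a i i' j' = 0 := by
    intro i j i' j' hi hj
    have hc := hγ i j
    have hc' := hγ i' j'
    obtain ⟨L, hL⟩ := exists_continuous_log
      (⟨fun p : ℝ × ℝ => γ i j p.1 - γ i' j' p.2, by fun_prop⟩ : C(ℝ × ℝ, ℂ))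
      (fun p => sub_ne_zero.2 (hd i j i' j' hi hj p.1 p.2))
    simp only [ContinuousMap.coe_mk] at hL
    rw [← ha i' i j hi.symm (fun s => L (s, 0)) (by fun_prop) ⟨1, fun s => by rw [hL, h0, one_mul]⟩,
      ← hb j i' j' hj (fun t => L (1, t)) (by fun_prop) ⟨-1, fun t => by rw [hL, h1]; ring⟩,
      ← hb j' i j hj.symm (fun s => L (s, 1)) (by fun_prop) ⟨1, fun s => by rw [hL, h1, one_mul]⟩,
      ← ha i i' j' hi (fun t => L (0, t)) (by fun_prop) ⟨-1, fun t => by rw [hL, h0]; ring⟩]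
    ring
  have hlog : ∀ k i j, k ≠ i →
      Complex.exp (a k i j) = (B j - A k) / (A i - A k) := by
    intro k i j hk
    obtain ⟨L, hL⟩ := exists_continuous_log
      (⟨fun s => γ i j s - A k, (hγ i j).sub continuous_const⟩ : C(ℝ, ℂ)) (hAγ k i j hk)
    simp only [ContinuousMap.coe_mk] at hL
    rw [← ha k i j hk L (by fun_prop) ⟨1, fun s => by rw [hL, one_mul]⟩, Complex.exp_sub, hL, hL,
      h0, h1]
  have hlog' : ∀ k i j, k ≠ j →
      Complex.exp (b k i j) = (B j - B k) / (A i - B k) := by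
    intro k i j hk
    obtain ⟨L, hL⟩ := exists_continuous_log
      (⟨fun s => γ i j s - B k, (hγ i j).sub continuous_const⟩ : C(ℝ, ℂ)) (hBγ k i j hk)
    simp only [ContinuousMap.coe_mk] at hL
    rw [← hb k i j hk L (by fun_prop) ⟨1, fun s => by rw [hL, one_mul]⟩, Complex.exp_sub, hL, hL,
      h0, h1]
  -- logarithms of the differences of the six points
  obtain ⟨α, hα, hα'⟩ : ∃ α : Fin 3 → Fin 3 → ℂ,
      (∀ k i, k ≠ i → Complex.exp (α k i) = A i - A k) ∧
      ∀ k i, k < i → α i k = α k i + Real.pi * Complex.I := by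
    refine ⟨fun k i => if k < i then Complex.log (A i - A k) else
      Complex.log (A k - A i) + Real.pi * Complex.I, fun k i h => ?_, fun k i h => ?_⟩
    · dsimp only
      split_ifs
      · exact Complex.exp_log (hA k i h)
      · rw [Complex.exp_add, Complex.exp_pi_mul_I, Complex.exp_log (hA i k h.symm)]
        ring
    · simp only [h, h.not_gt, if_true, if_false]
  obtain ⟨β, hβ, hβ'⟩ : ∃ β : Fin 3 → Fin 3 → ℂ,
      (∀ k i, k ≠ i → Complex.exp (β k i) = B i - B k) ∧
      ∀ k i, k < i → β i k = β k i + Real.pi * Complex.I := by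
    refine ⟨fun k i => if k < i then Complex.log (B i - B k) else
      Complex.log (B k - B i) + Real.pi * Complex.I, fun k i h => ?_, fun k i h => ?_⟩
    · dsimp only
      split_ifs
      · exact Complex.exp_log (hB k i h)
      · rw [Complex.exp_add, Complex.exp_pi_mul_I, Complex.exp_log (hB i k h.symm)]
        ring
    · simp only [h, h.not_gt, if_true, if_false]
  have hn : ∀ k i j, ∃ n : ℤ, k ≠ i →
      a k i j = Complex.log (B j - A k) - α k i + n * (2 * Real.pi * Complex.I) := by
    intro k i j
    by_cases hk : k = i
    · exact ⟨0, fun h => absurd hk h⟩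
    · obtain ⟨n, hn⟩ := Complex.exp_eq_exp_iff_exists_int.1
        (show Complex.exp (a k i j) = Complex.exp (Complex.log (B j - A k) - α k i) by
          rw [hlog k i j hk, Complex.exp_sub, hα k i hk, Complex.exp_log (hAB k j)])
      exact ⟨n, fun _ => hn⟩
  -- Using `log (B k - A i) + πi` as logarithm of `A i - B k` makes the mixed logarithms in `hn` and
  -- `hm` cancel in `hsq`.
  have hm : ∀ k i j, ∃ n : ℤ, k ≠ j → b k i j = β k j -
      (Complex.log (B k - A i) + Real.pi * Complex.I) + n * (2 * Real.pi * Complex.I) := by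
    intro k i j
    by_cases hk : k = j
    · exact ⟨0, fun h => absurd hk h⟩
    · obtain ⟨n, hn⟩ := Complex.exp_eq_exp_iff_exists_int.1
        (show Complex.exp (b k i j) =
            Complex.exp (β k j - (Complex.log (B k - A i) + Real.pi * Complex.I)) by
          rw [hlog' k i j hk, Complex.exp_sub, hβ k j hk, Complex.exp_add, Complex.exp_pi_mul_I,
            Complex.exp_log (hAB i k)]
          congr 1
          ring)
      exact ⟨n, fun _ => hn⟩
  choose n hn using hn
  choose m hm using hm
  have hint : ∀ z : ℤ, (z : ℂ) * (2 * Real.pi * Complex.I) = 0 → z = 0 := fun z hz => by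
    simpa [Complex.two_pi_I_ne_zero] using hz
  -- Exchanging two points shifts `α` or `β` by `πi`. The two shifts add up to a full turn when the
  -- orders of the indices agree, and cancel in `key2` when they disagree.
  have key1 : ∀ i j i' j', i < i' → j < j' →
      n i' i j + m j i' j' - m j' i j - n i i' j' - 1 = 0 := by
    intro i j i' j' hi hj
    refine hint _ ?_
    rw [← hsq i j i' j' hi.ne hj.ne, hn i' i j hi.ne', hm j i' j' hj.ne, hm j' i j hj.ne',
      hn i i' j' hi.ne, hα' i i' hi, hβ' j j' hj]
    push_cast
    ring
  have key2 : ∀ i j i' j', i < i' → j' < j →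
      n i' i j + m j i' j' - m j' i j - n i i' j' = 0 := by
    intro i j i' j' hi hj
    refine hint _ ?_
    rw [← hsq i j i' j' hi.ne hj.ne', hn i' i j hi.ne', hm j i' j' hj.ne', hm j' i j hj.ne,
      hn i i' j' hi.ne, hα' i i' hi, hβ' j' j hj]
    push_cast
    ring
  have e01 : (0 : Fin 3) < 1 := by decide
  have e02 : (0 : Fin 3) < 2 := by decide
  have e12 : (1 : Fin 3) < 2 := by decide
  -- Sum of the six relations for `i, i'`: every `n` occurs twice, and the `m` group into a quantity
  -- depending on `i'` minus the same quantity for `i`.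
  have key : ∀ i i', i < i' → ∃ z w : Fin 3 → ℤ, (∀ k, z k = m k i 0 + m k i 1 + m k i 2 - m k i k) ∧
      (∀ k, w k = m k i' 0 + m k i' 1 + m k i' 2 - m k i' k) ∧
      2 * (n i' i 0 + n i' i 1 + n i' i 2 - n i i' 0 - n i i' 1 - n i i' 2) +
        (w 0 + w 1 + w 2) - (z 0 + z 1 + z 2) = 3 := by
    intro i i' hi
    refine ⟨_, _, fun _ => rfl, fun _ => rfl, ?_⟩
    have := key1 i 0 i' 1 hi e01
    have := key1 i 0 i' 2 hi e02
    have := key1 i 1 i' 2 hi e12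
    have := key2 i 1 i' 0 hi e01
    have := key2 i 2 i' 0 hi e02
    have := key2 i 2 i' 1 hi e12
    linarith
  obtain ⟨z, w, hz, hw, h⟩ := key 0 1 e01
  obtain ⟨z', w', hz', hw', h'⟩ := key 0 2 e02
  obtain ⟨z'', w'', hz'', hw'', h''⟩ := key 1 2 e12
  have hzz : ∀ k, z' k = z k := fun k => by rw [hz, hz']
  have hzw : ∀ k, z'' k = w k := fun k => by rw [hw, hz'']
  have hww : ∀ k, w'' k = w' k := fun k => by rw [hw', hw'']
  rw [hzz, hzz, hzz] at h'
  rw [hzw, hzw, hzw, hww, hww, hww] at h''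
  -- In `h - h' + h''` the sums of `z` and `w` telescope away, leaving an even number equal to 3.
  omega

/-- A graph containing `K₃,₃` is not planar. -/
theorem not_isPlanar_of_forall_adj {V : Type*} {Γ : SimpleGraph V} (f g : Fin 3 → V)
    (hf : Function.Injective f) (hg : Function.Injective g) (h : ∀ i j, Γ.Adj (f i) (g j)) :
    ¬ IsPlanar Γ := by
  rintro ⟨D⟩
  have hfg : ∀ i j, f i ≠ g j := fun i j => (h i j).ne
  have key : ∀ i j, ∃ γ : unitInterval → ℝ × ℝ, Continuous γ ∧ γ 0 = D.point (f i) ∧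
      γ 1 = D.point (g j) ∧ ∀ s, ∃ t, γ s = D.arc ⟨s(f i, g j), h i j⟩ t := by
    intro i j
    have he := D.arc_ends ⟨s(f i, g j), h i j⟩
    simp only [Sym2.map_mk, Sym2.eq_iff] at he
    rcases he with he | he
    · exact ⟨_, D.arc_continuous _, he.1, he.2, fun s => ⟨s, rfl⟩⟩
    · exact ⟨fun s => D.arc _ (unitInterval.symm s),
        (D.arc_continuous _).comp unitInterval.continuous_symm, by simpa using he.2,
        by simpa using he.1, fun s => ⟨_, rfl⟩⟩
  choose γ hc h0 h1 hγ using key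
  let e := Complex.equivRealProdCLM.symm
  -- The arcs are extended to `ℝ` as constants outside the unit interval.
  refine false_of_independent_arcs_disjoint (fun i => e (D.point (f i))) (fun j => e (D.point (g j)))
    (fun i j s => e (γ i j (Set.projIcc 0 1 zero_le_one s)))
    (fun i j => e.continuous.comp ((hc i j).comp continuous_projIcc))
    (fun i j => by rw [Set.projIcc_left]; exact congrArg e (h0 i j))
    (fun i j => by rw [Set.projIcc_right]; exact congrArg e (h1 i j)) ?_
  intro i j i' j' hi hj s t hst
  obtain ⟨s', hs'⟩ := hγ i j (Set.projIcc 0 1 zero_le_one s)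
  obtain ⟨t', ht'⟩ := hγ i' j' (Set.projIcc 0 1 zero_le_one t)
  have hst' := e.injective hst
  rw [hs', ht'] at hst'
  have hne : (⟨s(f i, g j), h i j⟩ : Γ.edgeSet) ≠ ⟨s(f i', g j'), h i' j'⟩ := by
    intro heq
    rcases Sym2.eq_iff.1 (congrArg Subtype.val heq) with h' | h'
    · exact hi (hf h'.1)
    · exact hfg _ _ h'.1
  obtain ⟨v, hv, hv', -⟩ := D.arc_inter _ _ hne _ _ hst'
  simp only [Sym2.mem_iff] at hv hv'
  rcases hv with rfl | rfl <;> rcases hv' with hv' | hv'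
  · exact hi (hf hv')
  · exact hfg _ _ hv'
  · exact hfg _ _ hv'.symm
  · exact hj (hg hv')

/-! ### A universal planar drawing: the strand graph. -/

/-- A system of arcs in the plane that meet only in common ends draws every graph whose edges
correspond to some of the arcs. -/
theorem isPlanar_of_arcs {V W E : Type*} {Γ : SimpleGraph V} {φ : V → W}
    (hφ : Function.Injective φ) {point : W → ℝ × ℝ} (hpoint : Function.Injective point)
    {src dst : E → W} {a : E → unitInterval → ℝ × ℝ} (hac : ∀ e, Continuous (a e))
    (hai : ∀ e, Function.Injective (a e)) (ha0 : ∀ e, a e 0 = point (src e))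
    (ha1 : ∀ e, a e 1 = point (dst e)) (hW : ∀ w, ∃ e, w = src e ∨ w = dst e)
    (hinter : ∀ e f, e ≠ f → ∀ s t, a e s = a f t →
      ∃ w, (w = src e ∨ w = dst e) ∧ (w = src f ∨ w = dst f) ∧ a e s = point w)
    (hΓ : ∀ u v, Γ.Adj u v → ∃ e, s(src e, dst e) = s(φ u, φ v)) : IsPlanar Γ := by
  have hvertex : ∀ e t w, a e t = point w → w = src e ∨ w = dst e := by
    intro e t w h
    obtain ⟨f, hf⟩ := hW w
    by_cases hef : e = f
    · rwa [hef]
    · obtain ⟨t', ht'⟩ : ∃ t', a f t' = point w := by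
        rcases hf with rfl | rfl
        exacts [⟨0, ha0 f⟩, ⟨1, ha1 f⟩]
      obtain ⟨w', hw', -, h'⟩ := hinter e f hef t t' (h.trans ht'.symm)
      rwa [hpoint (h.symm.trans h')]
  have hedge : ∀ e : Γ.edgeSet, ∃ i, s(src i, dst i) = (e : Sym2 V).map φ := by
    rintro ⟨e, he⟩
    induction e with
    | h u v => exact hΓ u v he
  choose ε hε using hedge
  have hmem : ∀ e w, w = src (ε e) ∨ w = dst (ε e) ↔ ∃ v ∈ (e : Sym2 V), φ v = w := by
    intro e w
    rw [← Sym2.mem_iff, hε, Sym2.mem_map]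
  refine ⟨⟨fun v => point (φ v), fun e => a (ε e), hpoint.comp hφ, fun e => hac _, fun e => hai _,
    fun e => ?_, fun e t v h => ?_, fun e f hef s t h => ?_⟩⟩
  · rw [ha0, ha1, ← Sym2.map_mk, hε, Sym2.map_map]
    rfl
  · obtain ⟨u, hu, huv⟩ := (hmem e _).1 (hvertex _ _ _ h)
    rwa [← hφ huv]
  · have hne : ε e ≠ ε f := fun h' => hef <| Subtype.ext <| Sym2.map.injective hφ <| by
      rw [← hε, ← hε, h']
    obtain ⟨w, hwe, hwf, hw⟩ := hinter _ _ hne _ _ h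
    obtain ⟨v, hv, rfl⟩ := (hmem e _).1 hwe
    obtain ⟨v', hv', hvv'⟩ := (hmem f _).1 hwf
    exact ⟨v, hv, hφ hvv' ▸ hv', hw⟩

/-- Vertices of the strand graph: two hubs, infinitely many vertices `mid k` joined to both hubs,
and for each `i` two vertices `link i σ` joined to `mid (3 * i)` and `mid (3 * i + 1)`. -/
inductive StrandVertex
  | hub (σ : Bool)
  | mid (k : ℕ)
  | link (i : ℕ) (σ : Bool)

/-- Edges of the strand graph. -/
inductive StrandEdge
  | hub (k : ℕ) (σ : Bool)
  | link (i : ℕ) (δ σ : Bool)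

namespace StrandEdge

/-- The end `mid k` of an edge of the strand graph. -/
def src : StrandEdge → StrandVertex
  | hub k _ => .mid k
  | link i δ _ => .mid (3 * i + δ.toNat)

/-- The other end of an edge of the strand graph. -/
def dst : StrandEdge → StrandVertex
  | hub _ σ => .hub σ
  | link i _ σ => .link i σ

/-- The sign attached to a Boolean. -/
def sign : Bool → ℝ
  | true => 1
  | false => -1

/-- Collapses the lines `y = ± 1` bounding a horizontal strip to points. -/
def pinch (x y : ℝ) : ℝ × ℝ := (x * (1 - |y|), y)

/-- The position of the vertices of the strand graph. -/
noncomputable def position : StrandVertex → ℝ × ℝ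
  | .hub σ => pinch 0 (sign σ)
  | .mid k => pinch k 0
  | .link i σ => pinch (3 * i + 1 / 2) (sign σ * (1 / 2))

/-- The arcs drawing the edges of the strand graph. -/
noncomputable def arc : StrandEdge → unitInterval → ℝ × ℝ
  | hub k σ, s => pinch k (sign σ * s)
  | link i false σ, s => pinch (3 * i + s / 2) (sign σ * (s / 2))
  | link i true σ, s => pinch (3 * i + 1 - s / 2) (sign σ * (s / 2))

theorem abs_sign_mul (σ : Bool) {x : ℝ} (hx : 0 ≤ x) : |sign σ * x| = x := by
  cases σ <;> simp [sign, abs_of_nonneg hx]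

/-- Pinching is injective off the lines `y = ± 1`, and the height is kept. So meeting arcs are at
the same distance from the axis, and off the axis and the pinched lines the strip coordinates agree.
-/
theorem pinch_eq_pinch {σ σ' : Bool} {x y x' y' : ℝ} (hy : 0 ≤ y) (hy' : 0 ≤ y')
    (h : pinch x (sign σ * y) = pinch x' (sign σ' * y')) :
    y = y' ∧ (y = 0 ∨ σ = σ') ∧ (y = 1 ∨ x = x') := by
  obtain ⟨h1, h2⟩ := Prod.mk.inj h
  have hyy : y = y' := by rw [← abs_sign_mul σ hy, h2, abs_sign_mul σ' hy']
  subst hyy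
  refine ⟨rfl, ?_, ?_⟩
  · by_contra! hne
    obtain ⟨h0, hσ⟩ := hne
    have : 0 < y := lt_of_le_of_ne hy h0.symm
    cases σ <;> cases σ' <;> simp only [sign] at h2 hσ <;> first | exact hσ rfl | linarith
  · rw [abs_sign_mul σ hy, abs_sign_mul σ' hy'] at h1
    by_cases h0 : y = 1
    · exact Or.inl h0
    · exact Or.inr (mul_right_cancel₀ (sub_ne_zero.2 (Ne.symm h0)) h1)

theorem arc_zero (e : StrandEdge) : arc e 0 = position (src e) := by
  rcases e with _ | ⟨i, δ, σ⟩
  · simp [arc, src, position]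
  · cases δ <;> simp [arc, src, position]

theorem arc_one (e : StrandEdge) : arc e 1 = position (dst e) := by
  rcases e with ⟨k, σ⟩ | ⟨i, δ, σ⟩
  · cases σ <;> simp [arc, dst, position, pinch, sign]
  · cases δ
    · simp [arc, dst, position]
    · simp only [arc, dst, position, Set.Icc.coe_one]
      norm_num [add_sub_assoc]

theorem continuous_arc (e : StrandEdge) : Continuous (arc e) := by
  rcases e with _ | ⟨i, δ, σ⟩
  · unfold arc pinch; fun_prop
  · cases δ <;> · unfold arc pinch; fun_prop

theorem injective_arc (e : StrandEdge) : Function.Injective (arc e) := by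
  intro s t h
  have hs := s.2.1
  have ht := t.2.1
  rcases e with _ | ⟨i, δ, σ⟩
  · exact Subtype.ext (pinch_eq_pinch hs ht h).1
  · cases δ
    all_goals
      have := (pinch_eq_pinch (by positivity) (by positivity) h).1
      exact Subtype.ext (by linarith)

theorem injective_position : Function.Injective position := by
  have hmid : ∀ k : ℕ, position (.mid k) = pinch k (sign true * 0) := fun k => by
    simp [position]
  have hhub : ∀ σ, position (.hub σ) = pinch 0 (sign σ * 1) := fun σ => by simp [position]
  have hlink : ∀ i σ, position (.link i σ) = pinch (3 * i + 1 / 2) (sign σ * (1 / 2)) :=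
    fun i σ => rfl
  rintro (σ | k | ⟨i, σ⟩) (σ' | k' | ⟨i', σ'⟩) h
  all_goals
    simp only [hmid, hhub, hlink] at h
    have := pinch_eq_pinch (by norm_num) (by norm_num) h
    norm_num at this
  · rw [this]
  · rw [this]
  · rw [this.1, this.2]

theorem arc_inter (e f : StrandEdge) (hef : e ≠ f) (s t : unitInterval) (h : arc e s = arc f t) :
    ∃ w, (w = src e ∨ w = dst e) ∧ (w = src f ∨ w = dst f) ∧ arc e s = position w := by
  have hs := s.2.1
  have ht := t.2.1
  have hs1 := s.2.2
  have ht1 := t.2.2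
  have hzero : (s : ℝ) = 0 → (t : ℝ) = 0 →
      ∃ w, (w = src e ∨ w = dst e) ∧ (w = src f ∨ w = dst f) ∧ arc e s = position w := by
    intro h0 h0'
    have h0 : s = 0 := Subtype.ext h0
    have h0' : t = 0 := Subtype.ext h0'
    rw [h0, h0', arc_zero, arc_zero] at h
    exact ⟨src e, Or.inl rfl, Or.inl (injective_position h), by rw [h0, arc_zero]⟩
  have hone : (s : ℝ) = 1 → (t : ℝ) = 1 →
      ∃ w, (w = src e ∨ w = dst e) ∧ (w = src f ∨ w = dst f) ∧ arc e s = position w := by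
    intro h0 h0'
    have h0 : s = 1 := Subtype.ext h0
    have h0' : t = 1 := Subtype.ext h0'
    rw [h0, h0', arc_one, arc_one] at h
    exact ⟨dst e, Or.inr rfl, Or.inr (injective_position h), by rw [h0, arc_one]⟩
  rcases e with ⟨k, σ⟩ | ⟨i, (_ | _), σ⟩ <;> rcases f with ⟨k', σ'⟩ | ⟨i', (_ | _), σ'⟩
  all_goals
    obtain ⟨h1, h2, h3⟩ := pinch_eq_pinch (by positivity) (by positivity) h
    by_cases h0 : (s : ℝ) = 0
    · exact hzero h0 (by linarith)
    replace h2 := h2.resolve_left (by first | exact h0 | positivity)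
    by_cases h0' : (s : ℝ) = 1 ∧ (t : ℝ) = 1
    · exact hone h0'.1 h0'.2
    have hs0 : (0 : ℝ) < s := lt_of_le_of_ne hs (Ne.symm h0)
    replace h3 := h3.resolve_left (fun h => by first | exact h0' ⟨h, h1 ▸ h⟩ | linarith)
  · exact absurd (by rw [h2, Nat.cast_injective h3]) hef
  -- A link arc off its ends stays strictly between consecutive integer abscissas, so it misses the
  -- vertical strands.
  · have h4 : (3 * i' : ℝ) < k := by linarith
    have h5 : (k : ℝ) < 3 * i' + 1 := by linarith
    norm_cast at h4 h5
    omega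
  · have h4 : (3 * i' : ℝ) < k := by linarith
    have h5 : (k : ℝ) < 3 * i' + 1 := by linarith
    norm_cast at h4 h5
    omega
  · have h4 : (3 * i : ℝ) < k' := by linarith
    have h5 : (k' : ℝ) < 3 * i + 1 := by linarith
    norm_cast at h4 h5
    omega
  · have h4 : (i : ℝ) = i' := by linarith
    exact absurd (by rw [h2, Nat.cast_injective h4]) hef
  -- The two halves of a link approach the abscissa `3 * i + 1 / 2` from opposite sides and reach it
  -- only at their final end.
  · have hs2 : (s : ℝ) < 1 := lt_of_le_of_ne hs1 fun h => h0' ⟨h, by linarith⟩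
    have h4 : (3 * i : ℝ) < 3 * i' + 1 := by linarith
    have h5 : (3 * i' : ℝ) < 3 * i := by linarith
    norm_cast at h4 h5
    omega
  · have h4 : (3 * i : ℝ) < k' := by linarith
    have h5 : (k' : ℝ) < 3 * i + 1 := by linarith
    norm_cast at h4 h5
    omega
  · have hs2 : (s : ℝ) < 1 := lt_of_le_of_ne hs1 fun h => h0' ⟨h, by linarith⟩
    have h4 : (3 * i' : ℝ) < 3 * i + 1 := by linarith
    have h5 : (3 * i : ℝ) < 3 * i' := by linarith
    norm_cast at h4 h5
    omega
  · have h4 : (i : ℝ) = i' := by linarith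
    exact absurd (by rw [h2, Nat.cast_injective h4]) hef

/-- A graph that embeds into the strand graph is planar. -/
theorem isPlanar_of_embedding {V : Type*} {Γ : SimpleGraph V} {φ : V → StrandVertex}
    (hφ : Function.Injective φ) (h : ∀ u v, Γ.Adj u v → ∃ e, s(src e, dst e) = s(φ u, φ v)) :
    IsPlanar Γ := by
  refine isPlanar_of_arcs hφ injective_position continuous_arc injective_arc arc_zero arc_one
    (fun w => ?_) arc_inter h
  rcases w with σ | k | ⟨i, σ⟩
  · exact ⟨hub 0 σ, Or.inr rfl⟩
  · exact ⟨hub k true, Or.inl rfl⟩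
  · exact ⟨link i true σ, Or.inr rfl⟩

end StrandEdge

/-! ### Proper powers and adjacency in a product of two `p`-groups. -/

/-- `b` is a power of `a`, but `a` is not a power of `b`. -/
def IsProperPower {G : Type*} [Group G] (b a : G) : Prop :=
  b ∈ Subgroup.zpowers a ∧ a ∉ Subgroup.zpowers b

namespace IsProperPower

variable {G : Type*} [Group G] {a b : G}

theorem one_left (ha : a ≠ 1) : IsProperPower 1 a :=
  ⟨one_mem _, by simpa using ha⟩

theorem ne_one (h : IsProperPower b a) : a ≠ 1 := by
  rintro rfl
  exact h.2 (one_mem _)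

theorem ne (h : IsProperPower b a) : b ≠ a := by
  rintro rfl
  exact h.2 (Subgroup.mem_zpowers b)

theorem of_orderOf_ne [Finite G] (h : b ∈ Subgroup.zpowers a) (hne : orderOf b ≠ orderOf a) :
    IsProperPower b a :=
  ⟨h, fun h' => hne (Nat.dvd_antisymm (orderOf_dvd_of_mem_zpowers h)
    (orderOf_dvd_of_mem_zpowers h'))⟩

theorem orderOf_dvd (h : IsProperPower b a) : orderOf b ∣ orderOf a :=
  orderOf_dvd_of_mem_zpowers h.1

theorem orderOf_ne [Finite G] (h : IsProperPower b a) : orderOf b ≠ orderOf a := by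
  intro heq
  have hle : Subgroup.zpowers b ≤ Subgroup.zpowers a := Subgroup.zpowers_le.2 h.1
  have := Subgroup.eq_of_le_of_card_ge hle (by rw [Nat.card_zpowers, Nat.card_zpowers, heq])
  exact h.2 (this ▸ Subgroup.mem_zpowers a)

theorem eq_one_of_pow_eq_one [Finite G] {p : ℕ} (hp : p.Prime) (h : IsProperPower b a)
    (ha : a ^ p = 1) : b = 1 := by
  have h1 := (Nat.dvd_prime hp).1 (orderOf_dvd_of_pow_eq_one ha)
  rcases h1 with h1 | h1
  · exact absurd (orderOf_eq_one_iff.1 h1) h.ne_one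
  · have h2 := (Nat.dvd_prime hp).1 (h1 ▸ h.orderOf_dvd)
    rcases h2 with h2 | h2
    · exact orderOf_eq_one_iff.1 h2
    · exact absurd (h2.trans h1.symm) h.orderOf_ne

end IsProperPower

theorem zpow_gcd_orderOf_mem_zpowers {G : Type*} [Group G] (z : G) (m : ℤ) :
    z ^ ((Int.gcd m (orderOf z) : ℕ) : ℤ) ∈ Subgroup.zpowers (z ^ m) := by
  refine Subgroup.mem_zpowers_iff.2 ⟨Int.gcdA m (orderOf z), ?_⟩
  rw [Int.gcd_eq_gcd_ab, zpow_add, zpow_mul, zpow_mul z (orderOf z : ℤ), zpow_natCast,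
    pow_orderOf_eq_one, one_zpow, mul_one]

/-- In a `p`-group two powers of a common element are powers of each other. -/
theorem IsPGroup.mem_zpowers_or_mem_zpowers {p : ℕ} [Fact p.Prime] {G : Type*} [Group G]
    (hG : IsPGroup p G) {a b z : G} (ha : a ∈ Subgroup.zpowers z) (hb : b ∈ Subgroup.zpowers z) :
    a ∈ Subgroup.zpowers b ∨ b ∈ Subgroup.zpowers a := by
  obtain ⟨m, rfl⟩ := Subgroup.mem_zpowers_iff.1 ha
  obtain ⟨n, rfl⟩ := Subgroup.mem_zpowers_iff.1 hb
  obtain ⟨k, hk⟩ := IsPGroup.iff_orderOf.1 hG z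
  have key : ∀ m n : ℤ, Int.gcd m (orderOf z) ∣ Int.gcd n (orderOf z) →
      z ^ n ∈ Subgroup.zpowers (z ^ m) := by
    intro m n h
    obtain ⟨c, hc⟩ := (Int.natCast_dvd_natCast.2 h).trans (Int.gcd_dvd_left n (orderOf z))
    rw [hc, zpow_mul]
    exact zpow_mem (zpow_gcd_orderOf_mem_zpowers z m) c
  have hdvd : ∀ m : ℤ, ∃ i, Int.gcd m (orderOf z) = p ^ i := fun m => by
    have h : Int.gcd m (orderOf z) ∣ p ^ k := by
      rw [← hk]
      exact Int.natCast_dvd_natCast.1 (Int.gcd_dvd_right m (orderOf z))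
    obtain ⟨i, -, hi⟩ := (Nat.dvd_prime_pow Fact.out).1 h
    exact ⟨i, hi⟩
  obtain ⟨i, hi⟩ := hdvd m
  obtain ⟨j, hj⟩ := hdvd n
  rcases le_total i j with hij | hij
  · exact Or.inr (key m n (by rw [hi, hj]; exact pow_dvd_pow p hij))
  · exact Or.inl (key n m (by rw [hi, hj]; exact pow_dvd_pow p hij))

/-- The Chinese remainder theorem merges the two exponents into one. -/
theorem mem_zpowers_prod_iff {P Q : Type*} [Group P] [Group Q] [Finite P] [Finite Q] {a b : P}
    {u v : Q} (h : (orderOf b).Coprime (orderOf v)) :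
    (a, u) ∈ Subgroup.zpowers (b, v) ↔ a ∈ Subgroup.zpowers b ∧ u ∈ Subgroup.zpowers v := by
  constructor
  · intro h'
    obtain ⟨k, hk⟩ := Subgroup.mem_zpowers_iff.1 h'
    exact ⟨Subgroup.mem_zpowers_iff.2 ⟨k, congrArg Prod.fst hk⟩,
      Subgroup.mem_zpowers_iff.2 ⟨k, congrArg Prod.snd hk⟩⟩
  · rintro ⟨ha, hu⟩
    obtain ⟨m, rfl⟩ := mem_powers_iff_mem_zpowers.2 ha
    obtain ⟨n, rfl⟩ := mem_powers_iff_mem_zpowers.2 hu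
    obtain ⟨k, hkm, hkn⟩ := Nat.chineseRemainder h m n
    refine mem_powers_iff_mem_zpowers.1 ⟨k, ?_⟩
    exact Prod.ext (pow_eq_pow_iff_modEq.2 hkm) (pow_eq_pow_iff_modEq.2 hkn)

theorem fullDifferenceGraph_adj {G : Type*} [Group G] {x y : G} :
    (fullDifferenceGraph G).Adj x y ↔ (∃ z, x ∈ Subgroup.zpowers z ∧ y ∈ Subgroup.zpowers z) ∧
      x ∉ Subgroup.zpowers y ∧ y ∉ Subgroup.zpowers x := by
  simp only [fullDifferenceGraph, SimpleGraph.sdiff_adj, enhancedPowerGraph, powerGraph]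
  constructor
  · rintro ⟨⟨hne, h⟩, h'⟩
    exact ⟨h, by tauto⟩
  · rintro ⟨h, h'⟩
    refine ⟨⟨?_, h⟩, by tauto⟩
    rintro rfl
    exact h'.1 (Subgroup.mem_zpowers x)

theorem MulEquiv.map_mem_zpowers_iff {G H : Type*} [Group G] [Group H] (e : G ≃* H) {x y : G} :
    e x ∈ Subgroup.zpowers (e y) ↔ x ∈ Subgroup.zpowers y := by
  simp only [Subgroup.mem_zpowers_iff, ← map_zpow, e.injective.eq_iff]

theorem fullDifferenceGraph_adj_map_iff {G H : Type*} [Group G] [Group H] (e : G ≃* H) {x y : G} :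
    (fullDifferenceGraph H).Adj (e x) (e y) ↔ (fullDifferenceGraph G).Adj x y := by
  simp only [fullDifferenceGraph_adj, e.map_mem_zpowers_iff, ← e.toEquiv.exists_congr_right,
    MulEquiv.toEquiv_eq_coe, MulEquiv.coe_toEquiv]

section Prod

variable {P Q : Type*} [Group P] [Group Q] [Finite P] [Finite Q] {p q : ℕ}

/-- A common root makes the entries comparable in each factor; non-adjacency in the power graph then
forces strict comparisons in opposite directions. Conversely, the larger entries of the two factors
form a common root. -/
theorem fullDifferenceGraph_prod_adj (hp : p.Prime) (hq : q.Prime) (hpq : p ≠ q)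
    (hP : IsPGroup p P) (hQ : IsPGroup q Q) {a b : P} {u v : Q} :
    (fullDifferenceGraph (P × Q)).Adj (a, u) (b, v) ↔
      (IsProperPower a b ∧ IsProperPower v u) ∨ (IsProperPower b a ∧ IsProperPower u v) := by
  have := Fact.mk hp
  have := Fact.mk hq
  have hco : ∀ (b : P) (v : Q), (orderOf b).Coprime (orderOf v) := by
    intro b v
    obtain ⟨i, hi⟩ := IsPGroup.iff_orderOf.1 hP b
    obtain ⟨j, hj⟩ := IsPGroup.iff_orderOf.1 hQ v
    rw [hi, hj]
    exact Nat.coprime_pow_primes _ _ hp hq hpq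
  simp only [fullDifferenceGraph_adj, mem_zpowers_prod_iff (hco _ _), Prod.exists, IsProperPower]
  constructor
  · rintro ⟨⟨c, w, ⟨hac, huw⟩, hbc, hvw⟩, h1, h2⟩
    have h3 := hP.mem_zpowers_or_mem_zpowers hac hbc
    have h4 := hQ.mem_zpowers_or_mem_zpowers huw hvw
    tauto
  · rintro (⟨h1, h2⟩ | ⟨h1, h2⟩)
    · exact ⟨⟨b, u, ⟨h1.1, Subgroup.mem_zpowers u⟩, Subgroup.mem_zpowers b, h2.1⟩, by tauto⟩
    · exact ⟨⟨a, v, ⟨Subgroup.mem_zpowers a, h2.1⟩, h1.1, Subgroup.mem_zpowers v⟩, by tauto⟩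

theorem not_isPlanar_differenceGraph {G : Type*} [Group G] (f g : Fin 3 → G)
    (hf : Function.Injective f) (hg : Function.Injective g)
    (h : ∀ i j, (fullDifferenceGraph G).Adj (f i) (g j)) : ¬ IsPlanar (differenceGraph G) := by
  refine not_isPlanar_of_forall_adj (Γ := differenceGraph G)
    (fun i => ⟨f i, _, h i 0⟩) (fun j => ⟨g j, _, (h 0 j).symm⟩)
    (fun i j hij => hf (congrArg Subtype.val hij)) (fun i j hij => hg (congrArg Subtype.val hij))
    fun i j => h i j

theorem not_isPlanar_of_isProperPower {G : Type*} [Group G] (e : G ≃* P × Q) (hp : p.Prime)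
    (hq : q.Prime) (hpq : p ≠ q) (hP : IsPGroup p P) (hQ : IsPGroup q Q) {y : Fin 3 → Q}
    {w : Fin 3 → P × Q} (hy : Function.Injective y) (hw : Function.Injective w)
    (hw1 : ∀ j, (w j).1 ≠ 1) (h : ∀ i j, IsProperPower (w j).2 (y i)) :
    ¬ IsPlanar (differenceGraph G) := by
  refine not_isPlanar_differenceGraph (fun i => e.symm (1, y i)) (fun j => e.symm (w j))
    (fun i j hij => hy (congrArg Prod.snd (e.symm.injective hij)))
    (fun i j hij => hw (e.symm.injective hij)) fun i j => ?_
  rw [fullDifferenceGraph_adj_map_iff]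
  exact (fullDifferenceGraph_prod_adj hp hq hpq hP hQ).2
    (Or.inl ⟨IsProperPower.one_left (hw1 j), h i j⟩)

-- Elements `(1, u)` go to hubs, `(a, 1)` to middle vertices, and `(b, u)` with both entries
-- nontrivial to links. `hQ3` limits the hubs to two, while `hP1` and `hP2` say that a link meets
-- only `a` and `a⁻¹`, which belong to no other `b`.
open Classical in
theorem isPlanar_differenceGraph_of_prod {G : Type*} [Group G] (e : G ≃* P × Q) (hp : p.Prime)
    (hq : q.Prime) (hpq : p ≠ q) (hP : IsPGroup p P) (hQ : IsPGroup q Q)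
    (hQ1 : ∀ u v : Q, IsProperPower u v → u = 1) (hQ3 : Nat.card Q ≤ 3)
    (hP1 : ∀ a b b' : P, b ≠ 1 → b' ≠ 1 → IsProperPower b a → IsProperPower b' a → b = b')
    (hP2 : ∀ a a' b : P, b ≠ 1 → IsProperPower b a → IsProperPower b a' → a' = a ∨ a' = a⁻¹) :
    IsPlanar (differenceGraph G) := by
  obtain ⟨f, hf⟩ : ∃ f : P → ℕ, Function.Injective f :=
    ⟨_, Fin.val_injective.comp (Finite.equivFin P).injective⟩
  obtain ⟨h, hh⟩ : ∃ h : Q → Bool, ∀ u v, u ≠ 1 → v ≠ 1 → h u = h v → u = v := by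
    have : Fintype Q := Fintype.ofFinite Q
    have hc : Fintype.card {u : Q // u ≠ 1} ≤ Fintype.card Bool := by
      rw [Fintype.card_subtype_compl, Fintype.card_subtype_eq, Fintype.card_bool]
      rw [Nat.card_eq_fintype_card] at hQ3
      omega
    obtain ⟨h⟩ := Function.Embedding.nonempty_of_card_le hc
    refine ⟨fun u => if hu : u = 1 then true else h ⟨u, hu⟩, fun u v hu hv huv => ?_⟩
    simp only [dif_neg hu, dif_neg hv] at huv
    exact congrArg Subtype.val (h.injective huv)
  -- Slots `3 * f b` and `3 * f b + 1` are kept for the at most two elements with proper power `b ≠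
  -- 1`; residue 2 takes the elements without one.
  let μ : P → ℕ := fun a => if hb : ∃ b, b ≠ 1 ∧ IsProperPower b a then
    3 * f hb.choose + (decide (f a < f a⁻¹)).toNat else 3 * f a + 2
  have hμ : ∀ a b, b ≠ 1 → IsProperPower b a →
      μ a = 3 * f b + (decide (f a < f a⁻¹)).toNat := by
    intro a b hb hba
    have hex : ∃ b, b ≠ 1 ∧ IsProperPower b a := ⟨b, hb, hba⟩
    simp only [μ, dif_pos hex]
    rw [hP1 a b hex.choose hb hex.choose_spec.1 hba hex.choose_spec.2]
  have hμinj : Function.Injective μ := by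
    intro a a' haa
    by_cases h1 : ∃ b, b ≠ 1 ∧ IsProperPower b a <;> by_cases h2 : ∃ b, b ≠ 1 ∧ IsProperPower b a'
    · obtain ⟨b, hb, hba⟩ := h1
      obtain ⟨b', hb', hba'⟩ := h2
      rw [hμ a b hb hba, hμ a' b' hb' hba'] at haa
      have hlt := Bool.toNat_lt (decide (f a < f a⁻¹))
      have hlt' := Bool.toNat_lt (decide (f a' < f a'⁻¹))
      have hbb : b = b' := hf (by omega)
      subst hbb
      rcases hP2 a a' b hb hba hba' with rfl | rfl
      · rfl
      -- Equal bits for `a` and `a⁻¹` would make `f a < f a⁻¹` equivalent to its reverse, which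
      -- forces equality.
      · have hd : decide (f a < f a⁻¹) = decide (f a⁻¹ < f a⁻¹⁻¹) :=
          (by decide : ∀ x y : Bool, x.toNat = y.toNat → x = y) _ _ (by omega)
        rw [inv_inv, decide_eq_decide] at hd
        exact hf (by omega)
    · obtain ⟨b, hb, hba⟩ := h1
      have hlt := Bool.toNat_lt (decide (f a < f a⁻¹))
      rw [hμ a b hb hba, show μ a' = 3 * f a' + 2 from dif_neg h2] at haa
      omega
    · obtain ⟨b, hb, hba⟩ := h2
      have hlt := Bool.toNat_lt (decide (f a' < f a'⁻¹))
      rw [hμ a' b hb hba, show μ a = 3 * f a + 2 from dif_neg h1] at haa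
      omega
    · rw [show μ a = 3 * f a + 2 from dif_neg h1, show μ a' = 3 * f a' + 2 from dif_neg h2] at haa
      exact hf (by omega)
  let φ : P × Q → StrandVertex := fun x => if x.2 = 1 then .mid (μ x.1) else
    if x.1 = 1 then .hub (h x.2) else .link (f x.1) (h x.2)
  have hφ : Function.Injective φ := by
    rintro ⟨a, u⟩ ⟨b, v⟩ hab
    simp only [φ] at hab
    split_ifs at hab with h1 h2 h3 h4 h5 h6 h7 h8
    · rw [hμinj (StrandVertex.mid.inj hab), h1, h2]
    · rw [h4, h6, hh u v h1 h5 (StrandVertex.hub.inj hab)]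
    · obtain ⟨hf', hh'⟩ := StrandVertex.link.inj hab
      rw [hf hf', hh u v h1 h7 hh']
  have hadj : ∀ a b u v, IsProperPower a b → IsProperPower v u →
      ∃ E, s(StrandEdge.src E, StrandEdge.dst E) = s(φ (a, u), φ (b, v)) := by
    intro a b u v hab hvu
    have hv : v = 1 := hQ1 _ _ hvu
    by_cases ha : a = 1
    · refine ⟨.hub (μ b) (h u), ?_⟩
      simp [φ, hv, hvu.ne_one, ha, StrandEdge.src, StrandEdge.dst]
    · refine ⟨.link (f a) (decide (f b < f b⁻¹)) (h u), ?_⟩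
      simp only [φ, hv, hvu.ne_one, ha, StrandEdge.src, StrandEdge.dst, if_true, if_false,
        hμ b a ha hab]
      exact Sym2.eq_swap
  refine StrandEdge.isPlanar_of_embedding (φ := fun x => φ (e x))
    (fun x y hxy => Subtype.ext (e.injective (hφ hxy))) fun x y hxy => ?_
  have hxy' := (fullDifferenceGraph_adj_map_iff e).2 (show (fullDifferenceGraph G).Adj x y from hxy)
  rcases (fullDifferenceGraph_prod_adj hp hq hpq hP hQ).1 hxy' with ⟨h1, h2⟩ | ⟨h1, h2⟩
  · exact hadj _ _ _ _ h1 h2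
  · obtain ⟨E, hE⟩ := hadj _ _ _ _ h1 h2
    exact ⟨E, hE.trans Sym2.eq_swap⟩

end Prod

/-! ### Obstructions to planarity in a product of two `p`-groups. -/

theorem exists_orderOf_eq_prime_pow {G : Type*} [Group G] {p : ℕ} [Fact p.Prime]
    (hG : IsPGroup p G) {k : ℕ} {g : G} (hg : g ^ p ^ k ≠ 1) : ∃ y : G, orderOf y = p ^ (k + 1) := by
  have hp : p.Prime := Fact.out
  obtain ⟨n, hn⟩ := IsPGroup.iff_orderOf.1 hG g
  have hkn : k + 1 ≤ n := by
    by_contra! h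
    exact hg (orderOf_dvd_iff_pow_eq_one.1 (hn ▸ pow_dvd_pow p (by omega)))
  refine ⟨g ^ p ^ (n - (k + 1)), ?_⟩
  rw [orderOf_pow_of_dvd (pow_pos hp.pos _).ne' (hn ▸ pow_dvd_pow p (by omega)), hn,
    Nat.pow_div (by omega) hp.pos]
  congr 1
  omega

theorem exponent_eq_prime {G : Type*} [Group G] [Nontrivial G] {p : ℕ} (hp : p.Prime)
    (h : ∀ g : G, g ^ p = 1) : Monoid.exponent G = p := by
  refine ((Nat.dvd_prime hp).1 (Monoid.exponent_dvd_of_forall_pow_eq_one h)).resolve_left fun h1 => ?_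
  exact not_subsingleton G (Monoid.exp_eq_one_iff.1 h1)

theorem IsPGroup.le_card {G : Type*} [Group G] [Nontrivial G] [Finite G] {p : ℕ} [Fact p.Prime]
    (hG : IsPGroup p G) : p ≤ Nat.card G := by
  obtain ⟨n, hn, h⟩ := hG.nontrivial_iff_card.1 ‹_›
  rw [h]
  exact Nat.le_self_pow hn.ne' p

theorem exists_ne_one_of_four_le_card {G : Type*} [Group G] [Finite G] (h : 4 ≤ Nat.card G) :
    ∃ f : Fin 3 → G, Function.Injective f ∧ ∀ i, f i ≠ 1 := by
  classical
  have : Fintype G := Fintype.ofFinite G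
  have hc : Fintype.card (Fin 3) ≤ Fintype.card {u : G // u ≠ 1} := by
    rw [Fintype.card_subtype_compl, Fintype.card_subtype_eq, Fintype.card_fin]
    rw [Nat.card_eq_fintype_card] at h
    omega
  obtain ⟨f⟩ := Function.Embedding.nonempty_of_card_le hc
  exact ⟨fun i => f i, Subtype.val_injective.comp f.injective, fun i => (f i).2⟩

theorem injective_vecCons_three {α : Type*} {a b c : α} (hab : a ≠ b) (hac : a ≠ c) (hbc : b ≠ c) :
    Function.Injective ![a, b, c] := by
  intro i j h
  fin_cases i <;> fin_cases j <;> simp_all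

section Prod

variable {P Q : Type*} [Group P] [Group Q] [Finite P] [Finite Q] {p q : ℕ} {G : Type*} [Group G]

theorem card_le_three_of_isPlanar (e : G ≃* P × Q) (hp : p.Prime)
    (hq : q.Prime) (hpq : p ≠ q) (hP : IsPGroup p P) (hQ : IsPGroup q Q)
    (h : IsPlanar (differenceGraph G)) : Nat.card P ≤ 3 ∨ Nat.card Q ≤ 3 := by
  by_contra! hc
  obtain ⟨f, hf, hf1⟩ := exists_ne_one_of_four_le_card hc.1
  obtain ⟨g, hg, hg1⟩ := exists_ne_one_of_four_le_card hc.2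
  exact not_isPlanar_of_isProperPower e hp hq hpq hP hQ hg (w := fun j => (f j, 1))
    (fun i j hij => hf (congrArg Prod.fst hij)) hf1 (fun i j => IsProperPower.one_left (hg1 i)) h

/-- For `y` of order `q ^ 2`, three generators of its cyclic group are joined to three pairs `(a, y
^ (q * j))`; `q ≥ 3` supplies enough of both. -/
theorem pow_prime_eq_one_of_isPlanar [Nontrivial P] (e : G ≃* P × Q) (hp : p.Prime)
    (hq : q.Prime) (hpq : p ≠ q) (hP : IsPGroup p P) (hQ : IsPGroup q Q) (hq3 : 3 ≤ q)
    (h : IsPlanar (differenceGraph G)) (g : Q) : g ^ q = 1 := by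
  have := Fact.mk hq
  by_contra hg
  obtain ⟨y, hy⟩ := exists_orderOf_eq_prime_pow (k := 1) hQ (g := g) (by rwa [pow_one])
  rw [one_add_one_eq_two] at hy
  obtain ⟨a, ha⟩ := exists_ne (1 : P)
  have hlt : q + 1 < q ^ 2 := by nlinarith
  have hinj : ∀ m n, m < q ^ 2 → n < q ^ 2 → y ^ m = y ^ n → m = n := fun m n hm hn hmn =>
    pow_injOn_Iio_orderOf (by simpa [hy]) (by simpa [hy]) hmn
  have hcop : ∀ m, q.Coprime m → y ∈ Subgroup.zpowers (y ^ m) := by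
    intro m hm
    exact mem_zpowers_pow_iff.2 (by rw [hy]; exact (hm.symm.pow_right 2))
  have hgen : ∀ i, y ∈ Subgroup.zpowers (![y ^ 1, y ^ 2, y ^ (q + 1)] i) := by
    intro i
    fin_cases i
    · exact hcop 1 (Nat.coprime_one_right q)
    · exact hcop 2 ((Nat.coprime_primes hq Nat.prime_two).2 (by omega))
    · exact hcop (q + 1) (by simp)
  have hys : Function.Injective ![y ^ 1, y ^ 2, y ^ (q + 1)] :=
    injective_vecCons_three
      (fun h => absurd (hinj 1 2 (by omega) (by omega) h) (by omega))
      (fun h => absurd (hinj 1 (q + 1) (by omega) (by omega) h) (by omega))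
      (fun h => absurd (hinj 2 (q + 1) (by omega) (by omega) h) (by omega))
  refine not_isPlanar_of_isProperPower e hp hq hpq hP hQ hys
    (w := fun j : Fin 3 => (a, y ^ (q * j.val))) (fun i j hij => ?_) (fun _ => ha)
    (fun i j => ?_) h
  · have hb : ∀ i : Fin 3, q * i.val < q ^ 2 := fun i => by
      rw [sq]
      exact Nat.mul_lt_mul_of_pos_left (by omega) hq.pos
    exact Fin.ext (Nat.eq_of_mul_eq_mul_left hq.pos
      (hinj _ _ (hb i) (hb j) (congrArg Prod.snd hij)))
  · have hmem : y ^ (q * j.val) ∈ Subgroup.zpowers (![y ^ 1, y ^ 2, y ^ (q + 1)] i) :=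
      pow_mem (hgen i) _
    refine ⟨hmem, fun h' => ?_⟩
    have h1 : y ∈ Subgroup.zpowers (y ^ (q * j.val)) :=
      (Subgroup.zpowers_le.2 h') (hgen i)
    have h2 : (y ^ (q * j.val)) ^ q = 1 := by
      rw [← pow_mul, ← orderOf_dvd_iff_pow_eq_one, hy]
      exact ⟨j.val, by ring⟩
    have h3 := (orderOf_dvd_of_mem_zpowers h1).trans (orderOf_dvd_of_pow_eq_one h2)
    have := Nat.le_of_dvd hq.pos (hy ▸ h3)
    omega

/-- With `c ≠ d` nontrivial in `P`, the elements `(c, 1)`, `(d, 1)`, `(c, x)` are adjacent to every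
`(1, y i)`. -/
theorem not_isPlanar_of_isProperPower_of_card (e : G ≃* P × Q) (hp : p.Prime)
    (hq : q.Prime) (hpq : p ≠ q) (hP : IsPGroup p P) (hQ : IsPGroup q Q) (hc : 3 ≤ Nat.card P)
    {x : Q} (hx : x ≠ 1) {y : Fin 3 → Q} (hy : Function.Injective y)
    (h : ∀ i, IsProperPower x (y i)) : ¬ IsPlanar (differenceGraph G) := by
  obtain ⟨c, hc1, d, hd1, hcd⟩ : ∃ c : P, c ≠ 1 ∧ ∃ d, d ≠ 1 ∧ c ≠ d := by
    have : Nontrivial P := Finite.one_lt_card_iff_nontrivial.1 (by omega)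
    obtain ⟨c, hc1⟩ := exists_ne (1 : P)
    by_contra! h'
    have hle : Nat.card P ≤ 2 := by
      rw [← Set.ncard_univ]
      refine (Set.ncard_le_ncard (t := {1, c}) (fun d _ => ?_)).trans
        (Set.ncard_insert_le _ _ |>.trans (by simp))
      by_cases hd : d = 1
      · exact Or.inl hd
      · exact Or.inr (h' c hc1 d hd).symm
    omega
  refine not_isPlanar_of_isProperPower e hp hq hpq hP hQ hy
    (w := ![(c, 1), (d, 1), (c, x)]) (injective_vecCons_three (by simp [hcd]) (by simp [hx.symm])
      (by simp [hcd.symm])) (fun j => ?_) (fun i j => ?_)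
  · fin_cases j <;> simp [hc1, hd1]
  · fin_cases j
    · exact IsProperPower.one_left (h i).ne_one
    · exact IsProperPower.one_left (h i).ne_one
    · exact h i

/-- In a cyclic group of order 8 the odd powers `y`, `y ^ 3`, `y ^ 5` share the proper power `y ^
4`. -/
theorem pow_four_eq_one_of_isPlanar (e : G ≃* P × Q) (hp : p.Prime) (hp2 : p ≠ 2)
    (hP : IsPGroup p P) (hQ : IsPGroup 2 Q) (hc : 3 ≤ Nat.card P)
    (h : IsPlanar (differenceGraph G)) (g : Q) : g ^ 4 = 1 := by
  by_contra hg
  obtain ⟨y, hy⟩ := exists_orderOf_eq_prime_pow (k := 2) hQ (g := g) (by simpa using hg)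
  norm_num at hy
  have hinj : ∀ m n, m < 8 → n < 8 → y ^ m = y ^ n → m = n := fun m n hm hn hmn =>
    pow_injOn_Iio_orderOf (by simpa [hy]) (by simpa [hy]) hmn
  have h4 : orderOf (y ^ 4) = 2 := by
    rw [orderOf_pow_of_dvd (by norm_num) (by rw [hy]; norm_num), hy]
  refine not_isPlanar_of_isProperPower_of_card e hp Nat.prime_two hp2 hP hQ hc (x := y ^ 4)
    (fun h => absurd (hinj 4 0 (by norm_num) (by norm_num) (by simpa using h)) (by norm_num))
    (y := fun i : Fin 3 => y ^ (2 * i.val + 1)) (fun i j hij => Fin.ext ?_) (fun i => ?_) h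
  · have := hinj _ _ (by omega) (by omega) hij
    omega
  · have hcop : Nat.Coprime (2 * i.val + 1) 8 := by fin_cases i <;> norm_num
    refine IsProperPower.of_orderOf_ne (pow_mem (mem_zpowers_pow_iff.2 (by rwa [hy])) 4) ?_
    rw [h4, Nat.Coprime.orderOf_pow (by rw [hy]; exact hcop.symm), hy]
    norm_num

theorem inf_eq_bot_of_isPlanar (e : G ≃* P × Q) (hp : p.Prime)
    (hq : q.Prime) (hpq : p ≠ q) (hP : IsPGroup p P) (hQ : IsPGroup q Q) (hc : 3 ≤ Nat.card P)
    (h : IsPlanar (differenceGraph G)) {M N : Subgroup Q} (hM : IsMaximalCyclic M)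
    (hN : IsMaximalCyclic N) (hMN : M ≠ N) : M ⊓ N = ⊥ := by
  by_contra hne
  obtain ⟨x, ⟨hxM, hxN⟩, hx⟩ := (Subgroup.bot_or_exists_ne_one _).resolve_left hne
  obtain ⟨y, rfl⟩ := Subgroup.isCyclic_iff_exists_zpowers_eq_top M |>.1 hM.prop
  obtain ⟨z, rfl⟩ := Subgroup.isCyclic_iff_exists_zpowers_eq_top N |>.1 hN.prop
  have hyz : y ∉ Subgroup.zpowers z := fun h' =>
    hMN (hM.eq_of_le hN.prop (Subgroup.zpowers_le.2 h'))
  have hzy : z ∉ Subgroup.zpowers y := fun h' =>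
    hMN (hN.eq_of_le hM.prop (Subgroup.zpowers_le.2 h')).symm
  have hxy : IsProperPower x y := ⟨hxM, fun h' => hyz (Subgroup.zpowers_le.2 hxN h')⟩
  have hxz : IsProperPower x z := ⟨hxN, fun h' => hzy (Subgroup.zpowers_le.2 hxM h')⟩
  -- An involution has no nontrivial proper power.
  have hyy : y ≠ y⁻¹ := fun hyy => hx <|
    hxy.eq_one_of_pow_eq_one Nat.prime_two (by rw [sq]; nth_rw 2 [hyy]; exact mul_inv_cancel y)
  refine not_isPlanar_of_isProperPower_of_card e hp hq hpq hP hQ hc hx (y := ![y, y⁻¹, z])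
    (injective_vecCons_three hyy ?_ ?_) (fun i => ?_) h
  · rintro rfl
    exact hyz (Subgroup.mem_zpowers _)
  · rintro rfl
    exact hzy (inv_mem (Subgroup.mem_zpowers _))
  · fin_cases i
    · exact hxy
    · exact ⟨by simpa using hxM, fun h' => hxy.2 (by simpa using h')⟩
    · exact hxz

end Prod

/-! ### Reduction to two primes and the Sylow decomposition. -/

theorem mem_zpowers_mul_of_coprime {G : Type*} [Group G] {x y : G} (h : Commute x y)
    (hxy : (orderOf x).Coprime (orderOf y)) : x ∈ Subgroup.zpowers (x * y) := by
  obtain ⟨k, hk1, hk0⟩ := Nat.chineseRemainder hxy 1 0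
  refine Subgroup.mem_zpowers_iff.2 ⟨k, ?_⟩
  rw [zpow_natCast, h.mul_pow, pow_eq_pow_iff_modEq.2 hk1, pow_eq_pow_iff_modEq.2 hk0, pow_one,
    pow_zero, mul_one]

theorem fullDifferenceGraph_adj_of_coprime {G : Type*} [Group G] {x y : G} (h : Commute x y)
    (hxy : (orderOf x).Coprime (orderOf y)) (hx : x ≠ 1) (hy : y ≠ 1) :
    (fullDifferenceGraph G).Adj x y := by
  refine fullDifferenceGraph_adj.2 ⟨⟨x * y, mem_zpowers_mul_of_coprime h hxy, ?_⟩, fun h' => ?_,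
    fun h' => ?_⟩
  · rw [h.eq]
    exact mem_zpowers_mul_of_coprime h.symm hxy.symm
  · exact hx (orderOf_eq_one_iff.1
      (hxy.eq_one_of_dvd (orderOf_dvd_of_mem_zpowers h')))
  · exact hy (orderOf_eq_one_iff.1
      (hxy.symm.eq_one_of_dvd (orderOf_dvd_of_mem_zpowers h')))

section Decomposition

variable {G : Type*} [Group G] [Finite G]

theorem commute_of_orderOf_prime [Group.IsNilpotent G] {p q : ℕ} (hp : p.Prime) (hq : q.Prime)
    (hpq : p ≠ q) {x y : G} (hx : orderOf x = p) (hy : orderOf y = q) : Commute x y := by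
  have := Fact.mk hp
  have := Fact.mk hq
  have hnormal : ∀ (r : ℕ) (_ : Fact r.Prime) (P : Sylow r G), (P : Subgroup G).Normal :=
    ((Group.isNilpotent_of_finite_tfae (G := G)).out 0 3).1 ‹_›
  obtain ⟨P, hP⟩ := (IsPGroup.of_card (p := p) (n := 1) (G := Subgroup.zpowers x)
    (by rw [Nat.card_zpowers, hx, pow_one])).exists_le_sylow
  obtain ⟨Q, hQ⟩ := (IsPGroup.of_card (p := q) (n := 1) (G := Subgroup.zpowers y)
    (by rw [Nat.card_zpowers, hy, pow_one])).exists_le_sylow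
  exact Subgroup.commute_of_normal_of_disjoint _ _ (hnormal p ‹_› P) (hnormal q ‹_› Q)
    (IsPGroup.disjoint_of_ne p q hpq _ _ P.2 Q.2) x y (hP (Subgroup.mem_zpowers x))
    (hQ (Subgroup.mem_zpowers y))

theorem card_primeFactors_le_two_of_isPlanar [Group.IsNilpotent G]
    (h : IsPlanar (differenceGraph G)) : (Nat.card G).primeFactors.card ≤ 2 := by
  by_contra! hc
  set S := (Nat.card G).primeFactors
  have hex : ∀ a b, ∃ r ∈ S, r ≠ a ∧ r ≠ b := by
    intro a b
    obtain ⟨r, hr, hr'⟩ := Finset.exists_mem_notMem_of_card_lt_card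
      ((Finset.card_le_two (a := a) (b := b)).trans_lt hc)
    simp only [Finset.mem_insert, Finset.mem_singleton, not_or] at hr'
    exact ⟨r, hr, hr'⟩
  -- Avoiding 2 and 3 gives `c` three nontrivial powers; `q` odd gives `b ≠ b ^ 2`, both of order
  -- `q`. With `a` these form the K₃,₃.
  obtain ⟨r, hr, hr2, hr3⟩ := hex 2 3
  obtain ⟨q, hq, hq2, hqr⟩ := hex 2 r
  obtain ⟨p, hp, hpq, hpr⟩ := hex q r
  have hprime : ∀ s ∈ S, s.Prime ∧ s ∣ Nat.card G := fun s hs =>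
    ⟨Nat.prime_of_mem_primeFactors hs, Nat.dvd_of_mem_primeFactors hs⟩
  obtain ⟨hr, hrG⟩ := hprime r hr
  obtain ⟨hq, hqG⟩ := hprime q hq
  obtain ⟨hp, hpG⟩ := hprime p hp
  have := Fact.mk hr
  have := Fact.mk hq
  have := Fact.mk hp
  obtain ⟨a, ha⟩ := exists_prime_orderOf_dvd_card' p hpG
  obtain ⟨b, hb⟩ := exists_prime_orderOf_dvd_card' q hqG
  obtain ⟨c, hc⟩ := exists_prime_orderOf_dvd_card' r hrG
  have hr4 : 4 ≤ r := by have := hr.two_le; omega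
  have hq3 : 3 ≤ q := by have := hq.two_le; omega
  have hac : Commute a c := commute_of_orderOf_prime hp hr hpr ha hc
  have hbc : Commute b c := commute_of_orderOf_prime hq hr hqr hb hc
  have hpc : p.Coprime r := (Nat.coprime_primes hp hr).2 hpr
  have hqc : q.Coprime r := (Nat.coprime_primes hq hr).2 hqr
  have hb2 : orderOf (b ^ 2) = q := by
    rw [Nat.Coprime.orderOf_pow (by rw [hb]; exact (Nat.coprime_primes hq Nat.prime_two).2 hq2), hb]
  have hne1 : ∀ {x : G} {s : ℕ}, s.Prime → orderOf x = s → x ≠ 1 := by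
    rintro x s hs hx rfl
    exact hs.one_lt.ne (by simpa using hx)
  have hci : ∀ i : Fin 3, orderOf (c ^ (i.val + 1)) = r := fun i => by
    rw [Nat.Coprime.orderOf_pow, hc]
    rw [hc]
    exact Nat.coprime_of_lt_prime (by omega) (by omega) hr
  refine not_isPlanar_differenceGraph (fun i : Fin 3 => c ^ (i.val + 1)) ![a, b, b ^ 2]
    (fun i j hij => Fin.ext ?_) (injective_vecCons_three ?_ ?_ ?_) (fun i j => ?_) h
  · have := pow_injOn_Iio_orderOf (x := c) (by simp only [hc, Set.mem_Iio]; omega)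
      (by simp only [hc, Set.mem_Iio]; omega) hij
    omega
  · rintro rfl
    exact hpq (ha.symm.trans hb)
  · rintro rfl
    exact hpq (ha.symm.trans hb2)
  · intro hbb
    rw [sq, left_eq_mul] at hbb
    exact hne1 hq hb hbb
  · refine (?_ : (fullDifferenceGraph G).Adj _ _).symm
    fin_cases j
    · exact fullDifferenceGraph_adj_of_coprime (hac.pow_right _) (by rw [hci]; exact ha ▸ hpc)
        (hne1 hp ha) (hne1 hr (hci i))
    · exact fullDifferenceGraph_adj_of_coprime (hbc.pow_right _) (by rw [hci]; exact hb ▸ hqc)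
        (hne1 hq hb) (hne1 hr (hci i))
    · exact fullDifferenceGraph_adj_of_coprime ((hbc.pow_left 2).pow_right _)
        (by rw [hci]; exact hb2 ▸ hqc) (hne1 hq hb2) (hne1 hr (hci i))

theorem nonempty_mulEquiv_prod_sylow [Group.IsNilpotent G] {p q : ℕ} [Fact p.Prime]
    [Fact q.Prime] (hpq : p ≠ q) (h : (Nat.card G).primeFactors = {p, q}) (P : Sylow p G)
    (Q : Sylow q G) : Nonempty (G ≃* P × Q) := by
  have hnormal : ∀ (r : ℕ) (_ : Fact r.Prime) (P : Sylow r G), (P : Subgroup G).Normal :=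
    ((Group.isNilpotent_of_finite_tfae (G := G)).out 0 3).1 ‹_›
  have hdisj : Disjoint (P : Subgroup G) (Q : Subgroup G) :=
    IsPGroup.disjoint_of_ne p q hpq _ _ P.2 Q.2
  let f := MonoidHom.noncommCoprod (P : Subgroup G).subtype (Q : Subgroup G).subtype
    (fun x y => Subgroup.commute_of_normal_of_disjoint _ _ (hnormal p ‹_› P) (hnormal q ‹_› Q)
      hdisj x y x.2 y.2)
  have hf : Function.Injective f :=
    (MonoidHom.noncommCoprod_injective _ _ _).2
      ⟨Subtype.val_injective, Subtype.val_injective, by simpa using hdisj⟩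
  have hcard : Nat.card (P × Q) = Nat.card G := by
    rw [Nat.card_prod, P.card_eq_multiplicity, Q.card_eq_multiplicity]
    conv_rhs => rw [← Nat.prod_factorization_pow_eq_self (Nat.card_pos (α := G)).ne',
      Nat.prod_factorization_eq_prod_primeFactors, h, Finset.prod_pair hpq]
  exact ⟨(MulEquiv.ofBijective f ((Nat.bijective_iff_injective_and_card f).2 ⟨hf, hcard⟩)).symm⟩

/-- A group of exponent two is a power of the cyclic group of order two. -/
theorem exists_mulEquiv_pi_of_exponent_two (h : Monoid.exponent G = 2) :
    ∃ k, Nonempty (G ≃* (Fin k → CyclicOfOrder 2)) := by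
  let _ : CommGroup G := { (inferInstance : Group G) with mul_comm := mul_comm_of_exponent_two h }
  let _ : Module (ZMod 2) (Additive G) := AddCommGroup.zmodModule fun x =>
    congrArg Additive.ofMul (h ▸ Monoid.pow_exponent_eq_one x.toMul)
  let L := (Module.finBasis (ZMod 2) (Additive G)).equivFun
  refine ⟨_, ⟨MulEquiv.mk' (L.toEquiv.trans
    (Equiv.piCongrRight fun _ => Multiplicative.ofAdd) : Additive G ≃ _) fun x y => ?_⟩⟩
  funext i
  exact congrArg (fun v => Multiplicative.ofAdd (v i)) (L.map_add x y)

end Decomposition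

/-! ### Planarity of the listed groups. -/

theorem card_cyclicOfOrder (p : ℕ) : Nat.card (CyclicOfOrder p) = p :=
  (Nat.card_congr Multiplicative.toAdd).trans (Nat.card_zmod p)

theorem pow_eq_one_cyclicOfOrder {p : ℕ} (x : CyclicOfOrder p) : x ^ p = 1 := by
  simpa [card_cyclicOfOrder] using pow_card_eq_one' (x := x)

theorem nonempty_mulEquiv_cyclicOfOrder {P : Type*} [Group P] {p : ℕ} (hp : p.Prime)
    (h : Nat.card P = p) : Nonempty (P ≃* CyclicOfOrder p) :=
  have := Fact.mk hp
  ⟨mulEquivOfPrimeCardEq (p := p) h (card_cyclicOfOrder p)⟩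

section Planar

variable {G P Q : Type*} [Group G] [Group P] [Group Q] [Finite P] [Finite Q] {p q : ℕ}

theorem isPlanar_differenceGraph_of_pow_prime_eq_one (e : G ≃* P × Q) (hp : p.Prime)
    (hq : q.Prime) (hpq : p ≠ q) (hP : ∀ x : P, x ^ p = 1) (hQ : ∀ x : Q, x ^ q = 1)
    (hQ3 : Nat.card Q ≤ 3) : IsPlanar (differenceGraph G) :=
  isPlanar_differenceGraph_of_prod e hp hq hpq (fun x => ⟨1, by rw [pow_one, hP]⟩)
    (fun x => ⟨1, by rw [pow_one, hQ]⟩) (fun _ v h => h.eq_one_of_pow_eq_one hq (hQ v)) hQ3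
    (fun a _ _ hb _ h => absurd (h.eq_one_of_pow_eq_one hp (hP a)) hb)
    (fun a _ _ hb h => absurd (h.eq_one_of_pow_eq_one hp (hP a)) hb)

omit [Finite P] in
theorem eq_of_mem_zpowers_of_orderOf_eq_four {a b : P} (ha : orderOf a = 4)
    (h : b ∈ Subgroup.zpowers a) : b = 1 ∨ b = a ∨ b = a ^ 2 ∨ b = a⁻¹ := by
  classical
  have hfin : IsOfFinOrder a := orderOf_pos_iff.1 (by omega)
  obtain ⟨n, hn, rfl⟩ := Finset.mem_image.1 (hfin.mem_zpowers_iff_mem_range_orderOf.1 h)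
  rw [ha, Finset.mem_range] at hn
  interval_cases n
  · simp
  · simp
  · simp
  · refine Or.inr (Or.inr (Or.inr (eq_inv_of_mul_eq_one_left ?_)))
    rw [← pow_succ, ← orderOf_dvd_iff_pow_eq_one, ha]

theorem IsProperPower.eq_sq_of_pow_four_eq_one {a b : P} (ha : a ^ 4 = 1) (hb : b ≠ 1)
    (h : IsProperPower b a) : orderOf a = 4 ∧ b = a ^ 2 := by
  have h4 : orderOf a = 4 := orderOf_eq_prime_pow (p := 2) (n := 1)
    (fun h2 => hb (h.eq_one_of_pow_eq_one Nat.prime_two (by simpa using h2))) (by simpa using ha)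
  refine ⟨h4, ?_⟩
  rcases eq_of_mem_zpowers_of_orderOf_eq_four h4 h.1 with rfl | rfl | rfl | rfl
  · exact absurd rfl hb
  · exact absurd rfl h.ne
  · rfl
  · exact absurd (by simp) h.2

theorem isPlanar_differenceGraph_of_inf_eq_bot (e : G ≃* P × Q) (hq : q.Prime) (hq2 : 2 ≠ q)
    (hP : ∀ x : P, x ^ 4 = 1) (hQ : ∀ x : Q, x ^ q = 1) (hQ3 : Nat.card Q ≤ 3)
    (hPM : ∀ M N : Subgroup P, IsMaximalCyclic M → IsMaximalCyclic N → M ≠ N → M ⊓ N = ⊥) :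
    IsPlanar (differenceGraph G) := by
  have hmax : ∀ a : P, orderOf a = 4 → IsMaximalCyclic (Subgroup.zpowers a) := by
    intro a ha
    refine ⟨inferInstance, fun H hH hle => ?_⟩
    obtain ⟨g, rfl⟩ := Subgroup.isCyclic_iff_exists_zpowers_eq_top H |>.1 hH
    refine (Subgroup.eq_of_le_of_card_ge hle ?_).ge
    rw [Nat.card_zpowers, Nat.card_zpowers, ha]
    exact Nat.le_of_dvd (by norm_num) (orderOf_dvd_of_pow_eq_one (hP g))
  refine isPlanar_differenceGraph_of_prod e Nat.prime_two hq hq2 (fun x => ⟨2, hP x⟩)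
    (fun x => ⟨1, by rw [pow_one, hQ]⟩) (fun _ v h => h.eq_one_of_pow_eq_one hq (hQ v)) hQ3
    (fun a b b' hb hb' h h' => (h.eq_sq_of_pow_four_eq_one (hP a) hb).2.trans
      (h'.eq_sq_of_pow_four_eq_one (hP a) hb').2.symm)
    (fun a a' b hb h h' => ?_)
  obtain ⟨ha, hba⟩ := h.eq_sq_of_pow_four_eq_one (hP a) hb
  obtain ⟨ha', hba'⟩ := h'.eq_sq_of_pow_four_eq_one (hP a') hb
  -- Cyclic subgroups of order 4 are maximal cyclic here, so two of them sharing `b ≠ 1` coincide.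
  have heq : Subgroup.zpowers a = Subgroup.zpowers a' := by
    by_contra hne
    have hmem : b ∈ Subgroup.zpowers a ⊓ Subgroup.zpowers a' := ⟨h.1, h'.1⟩
    rw [hPM _ _ (hmax a ha) (hmax a' ha') hne] at hmem
    exact hb hmem
  rcases eq_of_mem_zpowers_of_orderOf_eq_four ha (heq ▸ Subgroup.mem_zpowers a') with
    rfl | rfl | rfl | rfl
  · simp at ha'
  · exact Or.inl rfl
  · rw [← pow_mul, hP] at hba'
    exact absurd hba' hb
  · exact Or.inr rfl

end Planar

/-! ### The classification. -/

theorem mainTheorem8 {G : Type u} [Group G] [Finite G] [Group.IsNilpotent G]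
    (hG : ¬ ∃ p : ℕ, p.Prime ∧ IsPGroup p G) :
    IsPlanar (differenceGraph G) ↔
      -- `ℤ₂ × P` with `P` a `p`-group of exponent `p > 2`
      (∃ (p : ℕ) (P : Type u) (_ : Group P), p.Prime ∧ 2 < p ∧ IsPGroup p P ∧
        Monoid.exponent P = p ∧ Nonempty (G ≃* CyclicOfOrder 2 × P)) ∨
      -- `ℤ₃ × P` with `P` a `p`-group of exponent `p > 3`
      (∃ (p : ℕ) (P : Type u) (_ : Group P), p.Prime ∧ 3 < p ∧ IsPGroup p P ∧
        Monoid.exponent P = p ∧ Nonempty (G ≃* CyclicOfOrder 3 × P)) ∨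
      -- `P × ℤ₃` with `P` a `2`-group of exponent `4` with trivially intersecting maximal
      -- cyclic subgroups
      (∃ (P : Type u) (_ : Group P), IsPGroup 2 P ∧ Monoid.exponent P = 4 ∧
        (∀ M N : Subgroup P, IsMaximalCyclic M → IsMaximalCyclic N → M ≠ N → M ⊓ N = ⊥) ∧
        Nonempty (G ≃* P × CyclicOfOrder 3)) ∨
      -- `ℤ₂ × ⋯ × ℤ₂ × ℤ₃`
      (∃ k : ℕ, 1 ≤ k ∧ Nonempty (G ≃* (Fin k → CyclicOfOrder 2) × CyclicOfOrder 3)) := by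
  constructor
  · intro h
    obtain ⟨p, q, hp, hq, hlt, hS⟩ : ∃ p q : ℕ, p.Prime ∧ q.Prime ∧ p < q ∧
        (Nat.card G).primeFactors = {p, q} := by
      have hcard := card_primeFactors_le_two_of_isPlanar h
      have hsub : ∀ p : ℕ, p.Prime → ¬ (Nat.card G).primeFactors ⊆ {p} := fun p hp hS =>
        hG ⟨p, hp, (isPGroup_iff_primeFactors_card_subset hp.ne_zero).2
          (by rwa [hp.primeFactors])⟩
      obtain ⟨p, q, hne, hS⟩ : ∃ p q, p ≠ q ∧ (Nat.card G).primeFactors = {p, q} := by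
        rw [← Finset.card_eq_two]
        by_contra hne
        have hle : (Nat.card G).primeFactors.card ≤ 1 := by omega
        obtain ⟨p, hp⟩ := Finset.card_le_one_iff_subset_singleton.1 hle
        by_cases hpp : p.Prime
        · exact hsub p hpp hp
        -- Here no prime divides the order, so any prime serves.
        · refine hsub 2 Nat.prime_two fun x hx => absurd ?_ hpp
          rw [← Finset.mem_singleton.1 (hp hx)]
          exact Nat.prime_of_mem_primeFactors hx
      have hp : p.Prime := Nat.prime_of_mem_primeFactors (n := Nat.card G) (by simp [hS])
      have hq : q.Prime := Nat.prime_of_mem_primeFactors (n := Nat.card G) (by simp [hS])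
      rcases lt_or_gt_of_ne hne with hlt | hlt
      · exact ⟨p, q, hp, hq, hlt, hS⟩
      · exact ⟨q, p, hq, hp, hlt, by rw [hS, Finset.pair_comm]⟩
    have := Fact.mk hp
    have := Fact.mk hq
    obtain ⟨P⟩ : Nonempty (Sylow p G) := inferInstance
    obtain ⟨Q⟩ : Nonempty (Sylow q G) := inferInstance
    obtain ⟨e⟩ := nonempty_mulEquiv_prod_sylow hlt.ne hS P Q
    have hpG : p ∣ Nat.card G := Nat.dvd_of_mem_primeFactors (by simp [hS])
    have hqG : q ∣ Nat.card G := Nat.dvd_of_mem_primeFactors (by simp [hS])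
    have hPnt : Nontrivial P := (Subgroup.nontrivial_iff_ne_bot _).2 (P.ne_bot_of_dvd_card hpG)
    have hQnt : Nontrivial Q := (Subgroup.nontrivial_iff_ne_bot _).2 (Q.ne_bot_of_dvd_card hqG)
    have hp2 := hp.two_le
    have hpP := P.2.le_card
    have hqQ := Q.2.le_card
    -- One factor has order at most 3. If it is `P`, forms (i) and (ii) arise; otherwise `p < q ≤ 3`
    -- forces `p = 2`, `q = 3`, and exponents 4 and 2 of `P` give (iii) and (iv).
    by_cases hcP : Nat.card P ≤ 3
    · have hexp : Monoid.exponent Q = q := exponent_eq_prime hq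
        (pow_prime_eq_one_of_isPlanar e hp hq hlt.ne P.2 Q.2 (by omega) h)
      have hcard : Nat.card P = p := by
        obtain ⟨n, hn, hn'⟩ := P.2.nontrivial_iff_card.1 hPnt
        rw [hn']
        by_contra hne
        have hn2 : 2 ≤ n := by
          by_contra hn2
          exact hne (by rw [show n = 1 by omega, pow_one])
        have := Nat.pow_le_pow_right hp.pos hn2
        nlinarith
      obtain ⟨c⟩ := nonempty_mulEquiv_cyclicOfOrder hp hcard
      have hp3 : p = 2 ∨ p = 3 := by omega
      rcases hp3 with rfl | rfl
      · exact Or.inl ⟨q, Q, inferInstance, hq, hlt, Q.2, hexp, ⟨e.trans (c.prodCongr (.refl _))⟩⟩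
      · exact Or.inr (Or.inl
          ⟨q, Q, inferInstance, hq, hlt, Q.2, hexp, ⟨e.trans (c.prodCongr (.refl _))⟩⟩)
    · have hcQ := (card_le_three_of_isPlanar e hp hq hlt.ne P.2 Q.2 h).resolve_left hcP
      have hq3 : q = 3 := by omega
      have hp2 : p = 2 := by omega
      subst hq3 hp2
      obtain ⟨c⟩ := nonempty_mulEquiv_cyclicOfOrder hq (le_antisymm hcQ hqQ)
      let e' : G ≃* Q × P := e.trans .prodComm
      have h4 := pow_four_eq_one_of_isPlanar e' hq (by norm_num) Q.2 P.2 hqQ h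
      refine Or.inr (Or.inr ?_)
      obtain ⟨k, hk, hexp⟩ := (Nat.dvd_prime_pow Nat.prime_two).1
        (show Monoid.exponent P ∣ 2 ^ 2 from Monoid.exponent_dvd_of_forall_pow_eq_one h4)
      interval_cases k
      · exact absurd (Monoid.exp_eq_one_iff.1 hexp) (not_subsingleton P)
      · obtain ⟨k, ⟨f⟩⟩ := exists_mulEquiv_pi_of_exponent_two (G := P) hexp
        refine Or.inr ⟨k, ?_, ⟨e.trans (f.prodCongr c)⟩⟩
        by_contra hk0
        obtain rfl : k = 0 := by omega
        exact not_subsingleton P f.toEquiv.subsingleton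
      · exact Or.inl ⟨P, inferInstance, P.2, hexp, fun M N hM hN hMN =>
          inf_eq_bot_of_isPlanar e' hq Nat.prime_two (by norm_num) Q.2 P.2 hqQ h hM hN hMN,
          ⟨e.trans ((MulEquiv.refl _).prodCongr c)⟩⟩
  · rintro (⟨p, P, _, hp, hp2, -, hexp, ⟨e⟩⟩ | ⟨p, P, _, hp, hp3, -, hexp, ⟨e⟩⟩ |
      ⟨P, _, -, hexp, hPM, ⟨e⟩⟩ | ⟨k, -, ⟨e⟩⟩)
    · have : Finite P := Finite.of_surjective _ (Prod.snd_surjective.comp e.surjective)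
      exact isPlanar_differenceGraph_of_pow_prime_eq_one (e.trans .prodComm) hp Nat.prime_two
        (by omega) (fun x => hexp ▸ Monoid.pow_exponent_eq_one x) pow_eq_one_cyclicOfOrder
        ((card_cyclicOfOrder 2).trans_le (by norm_num))
    · have : Finite P := Finite.of_surjective _ (Prod.snd_surjective.comp e.surjective)
      exact isPlanar_differenceGraph_of_pow_prime_eq_one (e.trans .prodComm) hp Nat.prime_three
        (by omega) (fun x => hexp ▸ Monoid.pow_exponent_eq_one x) pow_eq_one_cyclicOfOrder
        (card_cyclicOfOrder _).le
    · have : Finite P := Finite.of_surjective _ (Prod.fst_surjective.comp e.surjective)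
      exact isPlanar_differenceGraph_of_inf_eq_bot e Nat.prime_three (by norm_num)
        (fun x => hexp ▸ Monoid.pow_exponent_eq_one x) pow_eq_one_cyclicOfOrder
        (card_cyclicOfOrder _).le hPM
    · exact isPlanar_differenceGraph_of_pow_prime_eq_one e Nat.prime_two Nat.prime_three
        (by norm_num) (fun x => funext fun i => pow_eq_one_cyclicOfOrder (x i))
        pow_eq_one_cyclicOfOrder (card_cyclicOfOrder _).le
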